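/- Let $d\ge 6$ be an integer, $0\le F\le 1$, $|\psi_d^+\rangle=\frac1{\sqrt d}\sum_{i=1}^d|ii\rangle$, and let $$\rho_d^{iso}=F\,|\psi_d^+\rangle\langle\psi_d^+|+(1-F)\,\frac{I-|\psi_d^+\rangle\langle\psi_d^+|}{d^2-1}$$ be the isotropic state on $\mathbb C^d\otimes\mathbb C^d$. For $\alpha\in(0,1)$ let $S_\alpha^{\mathcal K}(\rho)=\frac1{2\alpha}\mathrm{Tr}[\rho^{1-\alpha}-\rho^{1+\alpha}]$ be the quantum Kaniadakis entropy of a density matrix $\rho$, and let $S_\alpha^{\mathcal K}(A|B)_{\rho_{AB}}=S_\alpha^{\mathcal K}(\rho_{AB})-S_\alpha^{\mathcal K}(\rho_B)$, with $\rho_B=\mathrm{Tr}_A\,\rho_{AB}$, be the conditional quantum Kaniadakis entropy. If $S_\alpha^{\mathcal K}(A|B)_{\rho_d^{iso}}<0$ for some $\alpha\in(0,1)$, then $\rho_d^{iso}$ is $2$-copy steerable for projective measurements. That is, the state $\rho_d^{iso}\otimes\rho_d^{iso}$, in which Alice holds the two systems $A$ and Bob the two systems $B$, is steerable from Alice to Bob: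 there are finitely many projective measurements $\{P_{a|x}\}_a$ on Alice's joint system $\mathbb C^d\otimes\mathbb C^d$ whose assemblage $\rho_{a|x}=\mathrm{Tr}_A[(P_{a|x}\otimes I)(\rho_d^{iso}\otimes\rho_d^{iso})]$ admits no local-hidden-state model $\rho_{a|x}=\int p(a|x,\lambda)\,\rho_\lambda\,d\pi(\lambda)$, where $\pi$ is a probability measure, each $\rho_\lambda$ is a density matrix on Bob's joint system, and each $p(\cdot|x,\lambda)$ is a probability distribution. -/

import Mathlib

open scoped Kronecker Matrix ComplexOrder

noncomputable section

namespace QSteer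

/-- A density matrix: positive semidefinite (in particular Hermitian) with unit trace. -/
structure IsDensityMatrix {B : Type} [Fintype B] (ρ : Matrix B B ℂ) : Prop where
  posSemidef : ρ.PosSemidef
  trace_eq_one : ρ.trace = 1

/-- The partial trace over the first tensor factor, `Tr_A`. -/
def partialTraceA {A B : Type} [Fintype A] (M : Matrix (A × B) (A × B) ℂ) : Matrix B B ℂ :=
  Matrix.of fun b b' => ∑ a, M (a, b) (a, b')

/-- The quantum Kaniadakis entropy `(1 / 2α) Tr[ρ^(1-α) - ρ^(1+α)]`. The real powers of the
Hermitian matrix `ρ` are taken by the functional calculus. -/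
def kaniadakisEntropy {B : Type} [Fintype B] [DecidableEq B] (α : ℝ) (ρ : Matrix B B ℂ) : ℝ :=
  1 / (2 * α) *
    (cfc (fun x : ℝ => x ^ (1 - α)) ρ - cfc (fun x : ℝ => x ^ (1 + α)) ρ).trace.re

/-- The conditional quantum Kaniadakis entropy `S(A|B) = S(ρ_AB) - S(ρ_B)`. -/
def condKaniadakisEntropy {A B : Type} [Fintype A] [DecidableEq A] [Fintype B] [DecidableEq B]
    (α : ℝ) (ρ : Matrix (A × B) (A × B) ℂ) : ℝ :=
  kaniadakisEntropy α ρ - kaniadakisEntropy α (partialTraceA ρ)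

/-- The maximally entangled vector `(1 / √d) ∑ i, |i i⟩`. -/
def maxEntangledVec (d : ℕ) : Fin d × Fin d → ℂ :=
  fun i => if i.1 = i.2 then ((1 / Real.sqrt d : ℝ) : ℂ) else 0

/-- The projector `|ψ⟩⟨ψ|` onto the maximally entangled vector. -/
def maxEntangledProj (d : ℕ) : Matrix (Fin d × Fin d) (Fin d × Fin d) ℂ :=
  Matrix.vecMulVec (maxEntangledVec d) (star (maxEntangledVec d))

/-- The isotropic state `F |ψ⟩⟨ψ| + (1 - F) (I - |ψ⟩⟨ψ|) / (d² - 1)`. -/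
def isotropicState (d : ℕ) (F : ℝ) : Matrix (Fin d × Fin d) (Fin d × Fin d) ℂ :=
  (F : ℂ) • maxEntangledProj d +
    ((1 - F : ℂ) / ((d : ℂ) ^ 2 - 1)) • (1 - maxEntangledProj d)

/-- The state `ρ^{⊗k}`, as a bipartite state: Alice holds the `k` systems `A`, Bob holds the `k`
systems `B`. -/
def copies {A B : Type} (k : ℕ) (ρ : Matrix (A × B) (A × B) ℂ) :
    Matrix ((Fin k → A) × (Fin k → B)) ((Fin k → A) × (Fin k → B)) ℂ :=
  Matrix.of fun s t => ∏ j, ρ (s.1 j, s.2 j) (t.1 j, t.2 j)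

/-- A projective measurement with finite outcome set `O`: orthogonal projections (of arbitrary
rank) that sum to the identity. -/
structure IsProjectiveMeasurement {A O : Type} [Fintype A] [DecidableEq A] [Fintype O]
    (P : O → Matrix A A ℂ) : Prop where
  isStarProjection : ∀ a, IsStarProjection (P a)
  sum_eq_one : ∑ a, P a = 1

/-- The steering assemblage `ρ_{a|x} = Tr_A[(P_{a|x} ⊗ I) ρ_AB]`. -/
def assemblage {A B X O : Type} [Fintype A] [Fintype B] [DecidableEq B]
    (P : X → O → Matrix A A ℂ) (ρ : Matrix (A × B) (A × B) ℂ) : X → O → Matrix B B ℂ :=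
  fun x a => partialTraceA ((P x a ⊗ₖ (1 : Matrix B B ℂ)) * ρ)

/-- An assemblage admits a local-hidden-state model if
`ρ_{a|x} = ∫ p(a|x,l) ρ_l dπ(l)` for some probability law `π` of a hidden variable `l`, some
hidden states `ρ_l` of Bob and some response functions `p(a|x,l)` of Alice. The integral of
matrices is written out entry by entry. -/
def HasLHSModel {B X O : Type} [Fintype B] [Fintype O] (σ : X → O → Matrix B B ℂ) : Prop :=
  ∃ (L : Type) (_ : MeasurableSpace L) (μ : MeasureTheory.Measure L)
    (τ : L → Matrix B B ℂ) (p : X → O → L → ℝ),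
    MeasureTheory.IsProbabilityMeasure μ ∧
    (∀ l, IsDensityMatrix (τ l)) ∧
    (∀ i j, Measurable fun l => τ l i j) ∧
    (∀ x a, Measurable (p x a)) ∧
    (∀ x a l, 0 ≤ p x a l) ∧
    (∀ x l, ∑ a, p x a l = 1) ∧
    ∀ x a i j, σ x a i j = ∫ l, (p x a l : ℂ) * τ l i j ∂μ

/-- `ρ_AB` is steerable (from Alice to Bob) for projective measurements: Alice has finitely many
projective measurements whose assemblage admits no local-hidden-state model. -/
def IsSteerableProjective {A B : Type} [Fintype A] [DecidableEq A] [Fintype B] [DecidableEq B]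
    (ρ : Matrix (A × B) (A × B) ℂ) : Prop :=
  ∃ (m n : ℕ) (P : Fin m → Fin n → Matrix A A ℂ),
    (∀ x, IsProjectiveMeasurement (P x)) ∧ ¬ HasLHSModel (assemblage P ρ)

/-- `ρ_AB` is `k`-copy steerable for projective measurements: `ρ_AB^{⊗k}` is steerable by
projective measurements performed collectively on Alice's `k` systems. -/
def IsKCopySteerableProjective {A B : Type} [Fintype A] [DecidableEq A] [Fintype B]
    [DecidableEq B] (k : ℕ) (ρ : Matrix (A × B) (A × B) ℂ) : Prop :=
  IsSteerableProjective (copies k ρ)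

end QSteer

end

/-! ### Entropy of the isotropic state -/

namespace QSteer

/-! Negative conditional entropy is used only through its consequence `1 / 2 < F`
(`half_lt_of_condKaniadakisEntropy_neg`): with `g x = x ^ (-α) - x ^ α`, which is decreasing,
negativity reads `F g(F) + (1 - F) g(p) < g(1/d)`, where `p` is the eigenvalue off the singlet.

Steering is detected by a linear functional. If Alice's projector is `v v*`, Bob tests `v̄ v̄*`. Two
copies dominate `F²` times the maximally entangled projector in dimension `d²`, so each unit vector
`v` contributes at least `F²/d²` (`le_dotProduct_copies_isotropicState`). For an odd prime `q ≤ d²`,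
the quadratic phases give `q` orthonormal bases of `ℂ^q ⊆ ℂ^(d²)` whose mutual overlaps are `1/√q`
by a Gauss sum. Their `q²` vectors give the value at least `q² F²/d²`. A hidden state can do no
better than pick one vector from each basis, and an almost-orthogonal Bessel inequality bounds this
by `1 + (q - 1)/√q` (`isSteerableProjective_of_overlap`).

As `F > 1/2`, it remains to find `q` with `1 + (q - 1)/√q ≤ q²/(4d²)`. Bertrand's postulate supplies
it for large `d`, explicit primes for the rest (`exists_prime_chirp_bound`). -/

/-- The matrix is annihilated by `(X - a)(X - b)`, so its spectrum lies in `{a, b}`, where `f`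
agrees with an affine function; the calculus of an affine function is explicit. -/
lemma cfc_projection_combination {A : Type} [Fintype A] [DecidableEq A]
    {Q : Matrix A A ℂ} (hQ : IsStarProjection Q) (f : ℝ → ℝ) (a b : ℝ) :
    cfc f ((a : ℂ) • Q + (b : ℂ) • (1 - Q)) = (f a : ℂ) • Q + (f b : ℂ) • (1 - Q) := by
  have hQQ : Q * Q = Q := hQ.isIdempotentElem
  have hQs : star Q = Q := hQ.isSelfAdjoint
  set M : Matrix A A ℂ := (a : ℂ) • Q + (b : ℂ) • (1 - Q) with hM
  have hMs : IsSelfAdjoint M := by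
    rw [isSelfAdjoint_iff, hM]
    simp [star_smul, star_sub, hQs]
  have hspec : ∀ x ∈ spectrum ℝ M, x = a ∨ x = b := by
    intro x hx
    have hpoly : Polynomial.aeval M ((Polynomial.X - Polynomial.C a) *
        (Polynomial.X - Polynomial.C b) : Polynomial ℝ) = 0 := by
      have h1 : M - algebraMap ℝ (Matrix A A ℂ) a = ((b - a : ℝ) : ℂ) • (1 - Q) := by
        rw [hM, Algebra.algebraMap_eq_smul_one, ← Complex.coe_smul]
        push_cast
        module
      have h2 : M - algebraMap ℝ (Matrix A A ℂ) b = ((a - b : ℝ) : ℂ) • Q := by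
        rw [hM, Algebra.algebraMap_eq_smul_one, ← Complex.coe_smul]
        push_cast
        module
      simp only [map_mul, map_sub, Polynomial.aeval_X, Polynomial.aeval_C, h1, h2]
      rw [smul_mul_smul_comm, sub_mul, one_mul, hQQ, sub_self, smul_zero]
    have h3 := spectrum.subset_polynomial_aeval M ((Polynomial.X - Polynomial.C a) *
        (Polynomial.X - Polynomial.C b) : Polynomial ℝ) ⟨x, hx, rfl⟩
    rw [hpoly] at h3
    have : Nontrivial (Matrix A A ℂ) := by
      by_contra hn
      rw [not_nontrivial_iff_subsingleton] at hn
      rw [spectrum.of_subsingleton] at hx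
      exact hx
    rw [spectrum.zero_eq] at h3
    simpa [sub_eq_zero] using h3
  obtain ⟨c, e, hca, hcb⟩ : ∃ c e : ℝ, f a = c * a + e ∧ f b = c * b + e := by
    by_cases hab : a = b
    · exact ⟨0, f a, by simp, by simp [hab]⟩
    · have : a - b ≠ 0 := sub_ne_zero.mpr hab
      refine ⟨(f a - f b) / (a - b), f a - (f a - f b) / (a - b) * a, by ring, ?_⟩
      field_simp
      ring
  have hlin : cfc f M = cfc (fun x : ℝ => c * x + e) M := by
    refine cfc_congr fun x hx => ?_
    rcases hspec x hx with rfl | rfl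
    · exact hca
    · exact hcb
  rw [hlin, cfc_add_const e (fun x : ℝ => c * x) M (by fun_prop), cfc_const_mul c (fun x : ℝ => x) M,
    cfc_id' ℝ M, hca, hcb, hM, Algebra.algebraMap_eq_smul_one, ← Complex.coe_smul,
    ← Complex.coe_smul]
  push_cast
  module

lemma dotProduct_maxEntangledVec {d : ℕ} (hd : d ≠ 0) :
    star (maxEntangledVec d) ⬝ᵥ maxEntangledVec d = 1 := by
  have hd' : (d : ℂ) ≠ 0 := Nat.cast_ne_zero.mpr hd
  have h : ((Real.sqrt d : ℝ) : ℂ) * ((Real.sqrt d : ℝ) : ℂ) = d := by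
    rw [← Complex.ofReal_mul, Real.mul_self_sqrt (Nat.cast_nonneg d)]
    simp
  simp only [dotProduct, Pi.star_apply, maxEntangledVec, Fintype.sum_prod_type]
  simp [← mul_inv, h, hd']

lemma isStarProjection_vecMulVec {A : Type} [Fintype A] [DecidableEq A] {v : A → ℂ}
    (hv : star v ⬝ᵥ v = 1) : IsStarProjection (Matrix.vecMulVec v (star v)) := by
  constructor
  · rw [IsIdempotentElem, Matrix.vecMulVec_mul_vecMulVec, hv, one_smul]
  · rw [isSelfAdjoint_iff, Matrix.star_eq_conjTranspose, Matrix.conjTranspose_vecMulVec, star_star]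

lemma isStarProjection_maxEntangledProj {d : ℕ} (hd : d ≠ 0) :
    IsStarProjection (maxEntangledProj d) :=
  isStarProjection_vecMulVec (dotProduct_maxEntangledVec hd)

lemma trace_maxEntangledProj {d : ℕ} (hd : d ≠ 0) : (maxEntangledProj d).trace = 1 := by
  rw [maxEntangledProj, Matrix.trace_vecMulVec, dotProduct_comm, dotProduct_maxEntangledVec hd]

lemma isotropicState_eq (d : ℕ) (F : ℝ) :
    isotropicState d F = (F : ℂ) • maxEntangledProj d +
      (((1 - F) / ((d : ℝ) ^ 2 - 1) : ℝ) : ℂ) • (1 - maxEntangledProj d) := by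
  simp [isotropicState]

lemma kaniadakisEntropy_isotropicState {d : ℕ} (hd : d ≠ 0) (α F : ℝ) :
    kaniadakisEntropy α (isotropicState d F) = 1 / (2 * α) *
      ((F ^ (1 - α) - F ^ (1 + α)) + ((d : ℝ) ^ 2 - 1) *
        (((1 - F) / ((d : ℝ) ^ 2 - 1)) ^ (1 - α) - ((1 - F) / ((d : ℝ) ^ 2 - 1)) ^ (1 + α))) := by
  rw [kaniadakisEntropy, isotropicState_eq,
    cfc_projection_combination (isStarProjection_maxEntangledProj hd),
    cfc_projection_combination (isStarProjection_maxEntangledProj hd)]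
  simp only [Matrix.trace_sub, Matrix.trace_add, Matrix.trace_smul, trace_maxEntangledProj hd,
    Matrix.trace_one, Fintype.card_prod, Fintype.card_fin, smul_eq_mul]
  congr 1
  have h : ((d * d : ℕ) : ℂ) - 1 = (((d : ℝ) ^ 2 - 1 : ℝ) : ℂ) := by push_cast; ring
  rw [h]
  norm_cast
  ring

lemma partialTraceA_isotropicState {d : ℕ} (hd : 2 ≤ d) (F : ℝ) :
    partialTraceA (isotropicState d F) = ((1 / d : ℝ) : ℂ) • (1 : Matrix (Fin d) (Fin d) ℂ) := by
  have hd0 : (d : ℂ) ≠ 0 := by exact_mod_cast (by omega : d ≠ 0)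
  have hd1 : (d : ℂ) ^ 2 - 1 ≠ 0 := by
    have : (2 : ℝ) ≤ d := by exact_mod_cast hd
    have h : ((d : ℝ) ^ 2 - 1) ≠ 0 := by nlinarith
    exact_mod_cast h
  have h : ((Real.sqrt d : ℝ) : ℂ) * ((Real.sqrt d : ℝ) : ℂ) = d := by
    rw [← Complex.ofReal_mul, Real.mul_self_sqrt (Nat.cast_nonneg d)]
    simp
  ext b b'
  have hP : ∑ a, maxEntangledProj d (a, b) (a, b') = if b = b' then 1 / (d : ℂ) else 0 := by
    simp only [maxEntangledProj, Matrix.vecMulVec_apply, Pi.star_apply, maxEntangledVec]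
    by_cases hb : b = b'
    · subst hb
      rw [Finset.sum_eq_single b] <;> simp +contextual [← mul_inv, h]
    · rw [if_neg hb]
      refine Finset.sum_eq_zero fun a _ => ?_
      by_cases h1 : a = b
      · simp [show a ≠ b' from fun h2 => hb (h1.symm.trans h2)]
      · simp [h1]
  have hO : ∑ a, (1 : Matrix (Fin d × Fin d) (Fin d × Fin d) ℂ) (a, b) (a, b') =
      if b = b' then (d : ℂ) else 0 := by
    by_cases hb : b = b' <;> simp [Matrix.one_apply, hb]
  simp only [partialTraceA, isotropicState, Matrix.of_apply, Matrix.add_apply, Matrix.smul_apply,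
    Matrix.sub_apply, smul_eq_mul, Finset.sum_add_distrib, ← Finset.mul_sum,
    Finset.sum_sub_distrib, hP, hO]
  simp only [Matrix.one_apply]
  by_cases hb : b = b'
  · simp only [hb, if_true]
    push_cast
    field_simp
    ring
  · simp [hb]

lemma kaniadakisEntropy_partialTraceA_isotropicState {d : ℕ} (hd : 2 ≤ d) (α F : ℝ) :
    kaniadakisEntropy α (partialTraceA (isotropicState d F)) =
      1 / (2 * α) * (d * ((1 / d : ℝ) ^ (1 - α) - (1 / d : ℝ) ^ (1 + α))) := by
  -- The scalar matrix is put in two-eigenvalue form with the projection `1`.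
  have h1 : ((1 / d : ℝ) : ℂ) • (1 : Matrix (Fin d) (Fin d) ℂ) =
      ((1 / d : ℝ) : ℂ) • 1 + ((1 / d : ℝ) : ℂ) • (1 - 1) := by simp
  rw [kaniadakisEntropy, partialTraceA_isotropicState hd, h1,
    cfc_projection_combination (IsStarProjection.one _),
    cfc_projection_combination (IsStarProjection.one _)]
  simp only [sub_self, smul_zero, add_zero, Matrix.trace_sub, Matrix.trace_smul, Matrix.trace_one,
    Fintype.card_fin, smul_eq_mul]
  congr 1
  norm_cast
  ring

lemma rpow_one_sub_sub_rpow_one_add {x : ℝ} (hx : 0 < x) (α : ℝ) :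
    x ^ (1 - α) - x ^ (1 + α) = x * (x ^ (-α) - x ^ α) := by
  rw [sub_eq_add_neg 1 α, Real.rpow_add hx, Real.rpow_add hx, Real.rpow_one]
  ring

lemma rpow_neg_sub_rpow_anti {α x y : ℝ} (hα : 0 ≤ α) (hx : 0 < x) (hxy : x ≤ y) :
    y ^ (-α) - y ^ α ≤ x ^ (-α) - x ^ α :=
  sub_le_sub (Real.rpow_le_rpow_of_nonpos hx hxy (by linarith))
    (Real.rpow_le_rpow hx.le hxy hα)

/-- With `t = x ^ (-α)`, this is `t² - t⁻² = (t - t⁻¹)(t + t⁻¹)` together with `t + t⁻¹ ≥ 2`. -/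
lemma two_mul_rpow_neg_sub_rpow_le {α x : ℝ} (hα : 0 ≤ α) (hx : 0 < x) (hx1 : x ≤ 1) :
    2 * (x ^ (-α) - x ^ α) ≤ (x ^ 2) ^ (-α) - (x ^ 2) ^ α := by
  have e : ∀ β : ℝ, (x ^ 2) ^ β = (x ^ β) ^ 2 := fun β => by
    rw [← Real.rpow_natCast, ← Real.rpow_natCast, ← Real.rpow_mul hx.le, ← Real.rpow_mul hx.le,
      mul_comm]
  rw [e, e]
  have h1 : x ^ (-α) * x ^ α = 1 := by rw [← Real.rpow_add hx]; simp
  have h2 : 0 ≤ x ^ (-α) - x ^ α := by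
    simpa using rpow_neg_sub_rpow_anti hα hx hx1
  have h3 : 2 ≤ x ^ (-α) + x ^ α := by
    have := Real.rpow_pos_of_pos hx (-α)
    have := Real.rpow_pos_of_pos hx α
    nlinarith
  nlinarith

/-- Negative conditional Kaniadakis entropy forces a singlet fraction above one half. -/
theorem half_lt_of_condKaniadakisEntropy_neg {d : ℕ} (hd : 2 ≤ d) {F α : ℝ} (hF0 : 0 ≤ F)
    (hF1 : F ≤ 1) (hα0 : 0 < α) (hα1 : α < 1)
    (h : condKaniadakisEntropy α (isotropicState d F) < 0) : 1 / 2 < F := by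
  by_contra! hF
  rw [condKaniadakisEntropy, kaniadakisEntropy_isotropicState (by omega),
    kaniadakisEntropy_partialTraceA_isotropicState hd, ← mul_sub] at h
  have hd' : (2 : ℝ) ≤ d := by exact_mod_cast hd
  have hd0 : (0 : ℝ) < 1 / d := by positivity
  have hN : (0 : ℝ) < (d : ℝ) ^ 2 - 1 := by nlinarith
  set N : ℝ := (d : ℝ) ^ 2 - 1 with hNdef
  set p : ℝ := (1 - F) / N with hp
  have hp0 : 0 < p := div_pos (by linarith) hN
  have hNp : N * p = 1 - F := by rw [hp]; field_simp
  rw [rpow_one_sub_sub_rpow_one_add hp0, rpow_one_sub_sub_rpow_one_add hd0] at h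
  have hlt := neg_of_mul_neg_right h (by positivity)
  rw [← mul_assoc, ← mul_assoc, hNp, mul_one_div_cancel (by positivity), one_mul] at hlt
  -- If `F ≤ 1/d²`, then `F ≤ p ≤ 1/d`, and monotonicity of `g` bounds the weighted mean below by
  -- `g(1/d)`. Otherwise `p ≤ 1/d²`, so `g(p) ≥ 2 g(1/d)`, and the weight `1 - F ≥ 1/2` suffices.
  rcases le_total F (1 / (d : ℝ) ^ 2) with hc | hc
  · have hFp : F ≤ p := by
      rw [hp, le_div_iff₀ hN]
      rw [le_div_iff₀ (by positivity)] at hc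
      rw [hNdef]
      linarith
    have hpd : p ≤ 1 / d := by
      rw [hp, div_le_div_iff₀ hN (by positivity)]
      nlinarith
    have h1 := rpow_neg_sub_rpow_anti hα0.le hp0 hpd
    have h2 : F * (p ^ (-α) - p ^ α) ≤ F ^ (1 - α) - F ^ (1 + α) := by
      rcases hF0.eq_or_lt with rfl | hFpos
      · rw [Real.zero_rpow (by linarith), Real.zero_rpow (by linarith)]
        simp
      · rw [rpow_one_sub_sub_rpow_one_add hFpos]
        exact mul_le_mul_of_nonneg_left (rpow_neg_sub_rpow_anti hα0.le hFpos hFp) hF0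
    linarith
  · have hFpos : 0 < F := lt_of_lt_of_le (by positivity) hc
    have hpd : p ≤ (1 / d) ^ 2 := by
      rw [hp, div_pow, one_pow, div_le_div_iff₀ hN (by positivity)]
      rw [div_le_iff₀ (by positivity)] at hc
      rw [hNdef]
      linarith
    have h1 := rpow_neg_sub_rpow_anti hα0.le hp0 hpd
    have h1d : (1 : ℝ) / d ≤ 1 := by
      rw [div_le_one (by positivity)]
      linarith
    have h2 := two_mul_rpow_neg_sub_rpow_le hα0.le hd0 h1d
    have h3 : 0 ≤ (1 / (d : ℝ)) ^ (-α) - (1 / (d : ℝ)) ^ α := by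
      simpa using rpow_neg_sub_rpow_anti hα0.le hd0 h1d
    have h4 : 0 ≤ F ^ (1 - α) - F ^ (1 + α) := by
      rw [rpow_one_sub_sub_rpow_one_add hFpos]
      refine mul_nonneg hF0 ?_
      simpa using rpow_neg_sub_rpow_anti hα0.le hFpos hF1
    nlinarith

end QSteer

/-! ### A steering inequality for families of orthonormal systems with small overlaps -/

section Gram

variable {E : Type*} [NormedAddCommGroup E] [InnerProductSpace ℂ E]

/-- A quantitative Bessel inequality for almost orthogonal unit vectors. -/
lemma sum_norm_inner_sq_le_of_norm_inner_le {ι : Type*} [Fintype ι] [Nonempty ι] (w : ι → E)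
    {μ : ℝ} (hμ : 0 ≤ μ) (hunit : ∀ x, ‖w x‖ = 1)
    (hoverlap : ∀ x y, x ≠ y → ‖inner ℂ (w x) (w y)‖ ≤ μ) (φ : E) :
    ∑ x, ‖inner ℂ (w x) φ‖ ^ 2 ≤ (1 + (Fintype.card ι - 1) * μ) * ‖φ‖ ^ 2 := by
  classical
  set c : ι → ℂ := fun x => inner ℂ (w x) φ with hc
  set S : ℝ := ∑ x, ‖c x‖ ^ 2 with hS
  set C : ℝ := 1 + (Fintype.card ι - 1) * μ with hC
  -- Since `⟨Φ, φ⟩ = S`, Cauchy–Schwarz gives `S² ≤ ‖Φ‖² ‖φ‖²`. The bound `‖Φ‖² ≤ C S` is a Schur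
  -- test on the Gram matrix, whose rows and columns of absolute values sum to at most `C`.
  set Φ : E := ∑ x, c x • w x with hΦ
  have hcard : (1 : ℝ) ≤ Fintype.card ι := by exact_mod_cast Fintype.card_pos
  have hC0 : 0 ≤ C := by
    have := mul_nonneg (sub_nonneg.mpr hcard) hμ
    linarith
  have hS0 : 0 ≤ S := Finset.sum_nonneg fun x _ => by positivity
  have h1 : inner ℂ Φ φ = (S : ℂ) := by
    rw [hΦ, sum_inner, hS, Complex.ofReal_sum]
    refine Finset.sum_congr rfl fun x _ => ?_
    rw [inner_smul_left, Complex.conj_mul']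
    simp
  have h2 : S ≤ ‖Φ‖ * ‖φ‖ := by
    have := norm_inner_le_norm (𝕜 := ℂ) Φ φ
    rwa [h1, Complex.norm_real, Real.norm_of_nonneg hS0] at this
  have h3 : ‖Φ‖ ^ 2 ≤ C * S := by
    have e : ((‖Φ‖ ^ 2 : ℝ) : ℂ) = ∑ x, ∑ y, starRingEnd ℂ (c x) * (c y * inner ℂ (w x) (w y)) := by
      have e0 : ((‖Φ‖ ^ 2 : ℝ) : ℂ) = inner ℂ Φ Φ := by
        rw [inner_self_eq_norm_sq_to_K]
        push_cast
        rfl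
      rw [e0, hΦ, sum_inner]
      refine Finset.sum_congr rfl fun x _ => ?_
      rw [inner_sum]
      refine Finset.sum_congr rfl fun y _ => ?_
      rw [inner_smul_left, inner_smul_right]
    have hb : ∀ x y, ‖starRingEnd ℂ (c x) * (c y * inner ℂ (w x) (w y))‖ ≤
        (‖c x‖ ^ 2 + ‖c y‖ ^ 2) / 2 * (if x = y then 1 else μ) := by
      intro x y
      have hxy : ‖inner ℂ (w x) (w y)‖ ≤ if x = y then 1 else μ := by
        split_ifs with h
        · subst h
          simp [hunit]
        · exact hoverlap x y h
      rw [norm_mul, norm_mul, ← mul_assoc, RCLike.norm_conj]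
      refine mul_le_mul ?_ hxy (norm_nonneg _) (by positivity)
      nlinarith [sq_nonneg (‖c x‖ - ‖c y‖)]
    have hrow : ∀ x : ι, ∑ y, (if x = y then 1 else μ) = C := by
      intro x
      have : ∀ y, (if x = y then 1 else μ) = μ + if x = y then 1 - μ else 0 := by
        intro y
        split_ifs <;> ring
      simp only [this, Finset.sum_add_distrib, Finset.sum_const, Finset.card_univ, nsmul_eq_mul,
        Finset.sum_ite_eq, Finset.mem_univ, if_true]
      rw [hC]
      ring
    have hcol : ∀ y : ι, ∑ x, (if x = y then 1 else μ) = C := fun y => by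
      simpa [eq_comm] using hrow y
    calc ‖Φ‖ ^ 2 = ‖((‖Φ‖ ^ 2 : ℝ) : ℂ)‖ := by
          rw [Complex.norm_real, Real.norm_of_nonneg (by positivity)]
      _ ≤ ∑ x, ∑ y, (‖c x‖ ^ 2 + ‖c y‖ ^ 2) / 2 * (if x = y then 1 else μ) := by
          rw [e]
          exact (norm_sum_le _ _).trans (Finset.sum_le_sum fun x _ =>
            (norm_sum_le _ _).trans (Finset.sum_le_sum fun y _ => hb x y))
      _ = ∑ x, ∑ y, ‖c x‖ ^ 2 / 2 * (if x = y then 1 else μ) +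
            ∑ x, ∑ y, ‖c y‖ ^ 2 / 2 * (if x = y then 1 else μ) := by
          simp only [← Finset.sum_add_distrib]
          refine Finset.sum_congr rfl fun x _ => Finset.sum_congr rfl fun y _ => ?_
          ring
      _ = C * S := by
          rw [Finset.sum_comm (f := fun x y => ‖c y‖ ^ 2 / 2 * (if x = y then 1 else μ))]
          simp only [← Finset.mul_sum, hrow, hcol]
          rw [← Finset.sum_mul, ← Finset.sum_div, hS]
          ring
  rcases hS0.eq_or_lt with h0 | hpos
  · rw [← h0]
    positivity
  · have h4 : S ^ 2 ≤ (C * S) * ‖φ‖ ^ 2 := by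
      calc S ^ 2 ≤ (‖Φ‖ * ‖φ‖) ^ 2 := by gcongr
        _ = ‖Φ‖ ^ 2 * ‖φ‖ ^ 2 := by ring
        _ ≤ _ := by gcongr
    nlinarith

end Gram

namespace QSteer

/-- Both sides are linear in `τ`, so splitting `τ` into rank-one terms reduces this to the Bessel
inequality. -/
lemma sum_dotProduct_mulVec_le_of_overlap {ι B : Type} [Fintype ι] [Nonempty ι] [Fintype B]
    {τ : Matrix B B ℂ} (hτ : τ.PosSemidef) (w : ι → B → ℂ) {μ : ℝ} (hμ : 0 ≤ μ)
    (hunit : ∀ x, star (w x) ⬝ᵥ w x = 1)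
    (hoverlap : ∀ x y, x ≠ y → ‖star (w x) ⬝ᵥ w y‖ ≤ μ) :
    ∑ x, (star (w x) ⬝ᵥ τ *ᵥ w x).re ≤ (1 + (Fintype.card ι - 1) * μ) * τ.trace.re := by
  obtain ⟨k, v, rfl⟩ := Matrix.posSemidef_iff_eq_sum_vecMulVec.mp hτ
  have hin : ∀ a b : B → ℂ, inner ℂ (WithLp.toLp 2 a) (WithLp.toLp 2 b) = star a ⬝ᵥ b := by
    intro a b
    rw [EuclideanSpace.inner_toLp_toLp, dotProduct_comm]
  have hquad : ∀ x i, (star (w x) ⬝ᵥ Matrix.vecMulVec (v i) (star (v i)) *ᵥ w x).re =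
      ‖inner ℂ (WithLp.toLp 2 (w x)) (WithLp.toLp 2 (v i))‖ ^ 2 := by
    intro x i
    rw [hin, Matrix.vecMulVec_mulVec, dotProduct_smul, op_smul_eq_smul, smul_eq_mul]
    have : star (v i) ⬝ᵥ w x = starRingEnd ℂ (star (w x) ⬝ᵥ v i) := by
      rw [starRingEnd_apply, Matrix.star_dotProduct]
    rw [this, Complex.conj_mul']
    norm_cast
  have htr : ∀ i, (Matrix.vecMulVec (v i) (star (v i))).trace.re =
      ‖(WithLp.toLp 2 (v i) : EuclideanSpace ℂ B)‖ ^ 2 := by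
    intro i
    rw [Matrix.trace_vecMulVec, dotProduct_comm, ← hin, inner_self_eq_norm_sq_to_K]
    norm_cast
  simp only [Matrix.sum_mulVec, dotProduct_sum, Complex.re_sum, Matrix.trace_sum, hquad, htr]
  rw [Finset.sum_comm, Finset.mul_sum]
  refine Finset.sum_le_sum fun i _ => ?_
  refine sum_norm_inner_sq_le_of_norm_inner_le (fun x => WithLp.toLp 2 (w x)) hμ ?_ ?_ _
  · intro x
    have h := inner_self_eq_norm_sq (𝕜 := ℂ) (WithLp.toLp 2 (w x) : EuclideanSpace ℂ B)
    rw [hin, hunit] at h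
    have h' : ‖(WithLp.toLp 2 (w x) : EuclideanSpace ℂ B)‖ ^ 2 = 1 := by simpa using h.symm
    exact (pow_eq_one_iff_of_nonneg (norm_nonneg _) two_ne_zero).mp h'
  · intro x y hxy
    rw [hin]
    exact hoverlap x y hxy

lemma trace_mul_vecMulVec_star {B : Type} [Fintype B] (τ : Matrix B B ℂ) (w : B → ℂ) :
    (τ * Matrix.vecMulVec w (star w)).trace = star w ⬝ᵥ τ *ᵥ w := by
  rw [Matrix.mul_vecMulVec, Matrix.trace_vecMulVec, dotProduct_comm]

/-- Needed to make the hidden-state integrands integrable, so that trace and integral commute.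
Off-diagonal entries are controlled by diagonal ones through a rank-one decomposition. -/
lemma IsDensityMatrix.norm_apply_le_one {B : Type} [Fintype B] {τ : Matrix B B ℂ}
    (hτ : IsDensityMatrix τ) (i j : B) : ‖τ i j‖ ≤ 1 := by
  classical
  have hdiag : ∀ i, ‖τ i i‖ ≤ 1 := by
    intro i
    have h1 : τ i i ≤ τ.trace :=
      Finset.single_le_sum (f := fun i => τ i i) (fun k _ => hτ.posSemidef.diag_nonneg)
        (Finset.mem_univ i)
    rw [hτ.trace_eq_one] at h1
    have h0 : 0 ≤ τ i i := hτ.posSemidef.diag_nonneg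
    have := CStarAlgebra.norm_le_norm_of_nonneg_of_le h0 h1
    simpa using this
  obtain ⟨k, v, hv⟩ := Matrix.posSemidef_iff_eq_sum_vecMulVec.mp hτ.posSemidef
  have happ : ∀ i j, τ i j = ∑ l, v l i * starRingEnd ℂ (v l j) := by
    intro i j
    rw [hv]
    simp [Matrix.sum_apply, Matrix.vecMulVec_apply]
  have hd : ∀ i, ∑ l, ‖v l i‖ ^ 2 ≤ 1 := by
    intro i
    have h := hdiag i
    rw [happ] at h
    simp only [Complex.mul_conj'] at h
    norm_cast at h
    exact (le_abs_self _).trans h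
  rw [happ]
  calc ‖∑ l, v l i * starRingEnd ℂ (v l j)‖ ≤ ∑ l, ‖v l i * starRingEnd ℂ (v l j)‖ :=
        norm_sum_le _ _
    _ ≤ ∑ l, (‖v l i‖ ^ 2 + ‖v l j‖ ^ 2) / 2 := by
        refine Finset.sum_le_sum fun l _ => ?_
        rw [norm_mul, RCLike.norm_conj]
        nlinarith [sq_nonneg (‖v l i‖ - ‖v l j‖)]
    _ ≤ 1 := by
        rw [← Finset.sum_div, Finset.sum_add_distrib]
        linarith [hd i, hd j]

/-- A linear functional bounded on all unsteered single-state assemblages is bounded on every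
assemblage with a local-hidden-state model. -/
lemma HasLHSModel.sum_trace_le {B X O : Type} [Fintype B] [Fintype X] [Fintype O]
    {σ : X → O → Matrix B B ℂ} (h : HasLHSModel σ) (M : X → O → Matrix B B ℂ) {C : ℝ}
    (hM : ∀ τ, IsDensityMatrix τ → ∀ p : X → O → ℝ, (∀ x a, 0 ≤ p x a) → (∀ x, ∑ a, p x a = 1) →
      ∑ x, ∑ a, p x a * (τ * M x a).trace.re ≤ C) :
    ∑ x, ∑ a, (σ x a * M x a).trace.re ≤ C := by
  obtain ⟨L, _, μ, τ, p, hprob, hτ, hτm, hpm, hp0, hp1, hσ⟩ := h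
  have hple : ∀ x a l, p x a l ≤ 1 := fun x a l => by
    rw [← hp1 x l]
    exact Finset.single_le_sum (f := fun a => p x a l) (fun a _ => hp0 x a l) (Finset.mem_univ a)
  have hint : ∀ x a i j, MeasureTheory.Integrable (fun l => (p x a l : ℂ) * τ l i j) μ := by
    intro x a i j
    refine MeasureTheory.Integrable.of_bound (C := 1) ?_ (Filter.Eventually.of_forall fun l => ?_)
    · exact ((Complex.measurable_ofReal.comp (hpm x a)).mul (hτm i j)).aestronglyMeasurable
    · rw [norm_mul, Complex.norm_real, Real.norm_of_nonneg (hp0 x a l)]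
      exact mul_le_one₀ (hple x a l) (norm_nonneg _) ((hτ l).norm_apply_le_one i j)
  have hexp : ∀ x a l, p x a l * (τ l * M x a).trace.re =
      (∑ i, ∑ j, (p x a l : ℂ) * τ l i j * M x a j i).re := by
    intro x a l
    rw [← Complex.re_ofReal_mul]
    simp only [Matrix.trace, Matrix.diag, Matrix.mul_apply, Finset.mul_sum, mul_assoc]
  have hintM : ∀ x a, MeasureTheory.Integrable
      (fun l => ∑ i, ∑ j, (p x a l : ℂ) * τ l i j * M x a j i) μ := fun x a =>
    MeasureTheory.integrable_finsetSum _ fun i _ => MeasureTheory.integrable_finsetSum _ fun j _ =>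
      (hint x a i j).mul_const _
  have hterm : ∀ x a, (σ x a * M x a).trace.re = ∫ l, p x a l * (τ l * M x a).trace.re ∂μ := by
    intro x a
    simp only [hexp]
    refine Eq.trans ?_ (integral_re (hintM x a)).symm
    change _ = Complex.re _
    rw [MeasureTheory.integral_finsetSum _ fun i _ =>
      MeasureTheory.integrable_finsetSum _ fun j _ => (hint x a i j).mul_const _]
    simp only [Matrix.trace, Matrix.diag, Matrix.mul_apply]
    congr 1
    refine Finset.sum_congr rfl fun i _ => ?_
    rw [MeasureTheory.integral_finsetSum _ fun j _ => (hint x a i j).mul_const _]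
    refine Finset.sum_congr rfl fun j _ => ?_
    rw [MeasureTheory.integral_mul_const, hσ]
  have hintR : ∀ x a, MeasureTheory.Integrable (fun l => p x a l * (τ l * M x a).trace.re) μ := by
    intro x a
    simp only [hexp]
    exact (hintM x a).re
  simp only [hterm]
  simp only [← MeasureTheory.integral_finsetSum Finset.univ (fun a _ => hintR _ a)]
  rw [← MeasureTheory.integral_finsetSum Finset.univ fun x _ =>
    MeasureTheory.integrable_finsetSum _ fun a _ => hintR x a]
  calc ∫ l, ∑ x, ∑ a, p x a l * (τ l * M x a).trace.re ∂μ ≤ ∫ _, C ∂μ := by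
        refine MeasureTheory.integral_mono ?_ (MeasureTheory.integrable_const C) fun l => ?_
        · exact MeasureTheory.integrable_finsetSum _ fun x _ =>
            MeasureTheory.integrable_finsetSum _ fun a _ => hintR x a
        · exact hM (τ l) (hτ l) (fun x a => p x a l) (fun x a => hp0 x a l) (fun x => hp1 x l)
    _ = C := by simp

lemma trace_partialTraceA_mul {A B : Type} [Fintype A] [DecidableEq A] [Fintype B]
    (N : Matrix (A × B) (A × B) ℂ) (M : Matrix B B ℂ) :
    (partialTraceA N * M).trace = (N * ((1 : Matrix A A ℂ) ⊗ₖ M)).trace := by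
  have h : ∀ a b, ∑ a', ∑ b', N (a, b) (a', b') * ((1 : Matrix A A ℂ) a' a * M b' b) =
      ∑ b', N (a, b) (a, b') * M b' b := by
    intro a b
    rw [Finset.sum_eq_single a] <;> simp +contextual
  simp only [Matrix.trace, Matrix.diag, Matrix.mul_apply, partialTraceA, Matrix.of_apply,
    Matrix.kroneckerMap_apply, Fintype.sum_prod_type, h, Finset.sum_mul]
  symm
  rw [Finset.sum_comm]
  exact Finset.sum_congr rfl fun b _ => Finset.sum_comm

/-- Alice's and Bob's correlated vector `v ⊗ v̄`. -/
def conjPair {A : Type} (v : A → ℂ) : A × A → ℂ := fun s => v s.1 * star (v s.2)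

/-- Alice's and Bob's rank-one projectors combine into the projector onto `v ⊗ v̄`. Conjugating on
Bob's side makes the overlap with the maximally entangled vector the same for every unit `v`. -/
lemma trace_assemblage_mul {A X O : Type} [Fintype A] [DecidableEq A]
    (P : X → O → Matrix A A ℂ) (ρ : Matrix (A × A) (A × A) ℂ) (x : X) (a : O) (v : A → ℂ)
    (hP : P x a = Matrix.vecMulVec v (star v)) :
    (assemblage P ρ x a * Matrix.vecMulVec (star v) (star (star v))).trace =
      star (conjPair v) ⬝ᵥ ρ *ᵥ conjPair v := by
  have h : ((1 : Matrix A A ℂ) ⊗ₖ Matrix.vecMulVec (star v) (star (star v))) *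
      (P x a ⊗ₖ (1 : Matrix A A ℂ)) =
      Matrix.vecMulVec (conjPair v) (star (conjPair v)) := by
    rw [← Matrix.mul_kronecker_mul, one_mul, mul_one, hP]
    ext s t
    simp only [Matrix.kroneckerMap_apply, Matrix.vecMulVec_apply, conjPair, Pi.star_apply,
      star_mul', star_star]
    ring
  rw [assemblage, trace_partialTraceA_mul, Matrix.trace_mul_comm, ← mul_assoc, h,
    Matrix.trace_mul_comm, trace_mul_vecMulVec_star]

/-- A sufficient criterion for steering: Alice measures orthonormal systems, each completed by a
remainder outcome, whose mutual overlaps are small. -/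
theorem isSteerableProjective_of_overlap {A : Type} [Fintype A] [DecidableEq A] {m n : ℕ}
    [NeZero m] [NeZero n] (ρ : Matrix (A × A) (A × A) ℂ) (v : Fin m → Fin n → A → ℂ) {μ : ℝ}
    (hμ : 0 ≤ μ) (horth : ∀ x a b, star (v x a) ⬝ᵥ v x b = if a = b then 1 else 0)
    (hoverlap : ∀ x y, x ≠ y → ∀ a b, ‖star (v x a) ⬝ᵥ v y b‖ ≤ μ)
    (hval : 1 + ((m : ℝ) - 1) * μ <
      ∑ x, ∑ a, (star (conjPair (v x a)) ⬝ᵥ ρ *ᵥ conjPair (v x a)).re) :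
    IsSteerableProjective ρ := by
  set P : Fin m → Fin (n + 1) → Matrix A A ℂ := fun x =>
    Fin.snoc (α := fun _ => Matrix A A ℂ) (fun a => Matrix.vecMulVec (v x a) (star (v x a)))
      (1 - ∑ a, Matrix.vecMulVec (v x a) (star (v x a))) with hP
  -- The remainder outcome is scored zero.
  set M : Fin m → Fin (n + 1) → Matrix A A ℂ := fun x =>
    Fin.snoc (α := fun _ => Matrix A A ℂ)
      (fun a => Matrix.vecMulVec (star (v x a)) (star (star (v x a)))) 0 with hM
  have hproj : ∀ x a, IsStarProjection (Matrix.vecMulVec (v x a) (star (v x a))) := fun x a =>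
    isStarProjection_vecMulVec (by rw [horth, if_pos rfl])
  have hsum : ∀ x, IsStarProjection (∑ a, Matrix.vecMulVec (v x a) (star (v x a))) := by
    intro x
    constructor
    · rw [IsIdempotentElem, Finset.sum_mul_sum]
      have hab : ∀ a b, Matrix.vecMulVec (v x a) (star (v x a)) *
          Matrix.vecMulVec (v x b) (star (v x b)) =
          if a = b then Matrix.vecMulVec (v x a) (star (v x a)) else 0 := by
        intro a b
        rw [Matrix.vecMulVec_mul_vecMulVec, horth]
        split_ifs with hab
        · rw [hab, one_smul]
        · rw [zero_smul, Matrix.vecMulVec_zero]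
      simp [hab]
    · rw [isSelfAdjoint_iff, star_sum]
      exact Finset.sum_congr rfl fun a _ => (hproj x a).isSelfAdjoint
  refine ⟨m, n + 1, P, fun x => ⟨?_, ?_⟩, fun hlhs => ?_⟩
  · intro a
    induction a using Fin.lastCases with
    | last => simpa [hP] using (hsum x).one_sub
    | cast a => simpa [hP] using hproj x a
  · simp [hP, Fin.sum_univ_castSucc]
  · refine absurd (hlhs.sum_trace_le M (C := 1 + ((m : ℝ) - 1) * μ) ?_) (not_le.mpr ?_)
    · intro τ hτ p hp0 hp1
      have hstar : ∀ a b : A → ℂ, star (star a) ⬝ᵥ star b = star (star a ⬝ᵥ b) := fun a b => by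
        rw [Matrix.star_dotProduct_star, dotProduct_comm, Matrix.star_dotProduct]
      set t : Fin m → Fin n → ℝ := fun x a =>
        (star (star (v x a)) ⬝ᵥ τ *ᵥ star (v x a)).re with ht
      have ht0 : ∀ x a, 0 ≤ t x a := fun x a => hτ.posSemidef.re_dotProduct_nonneg _
      -- Alice's best response to a fixed hidden state is deterministic: one vector `f x` per basis.
      -- The remainder outcome does no better, because `t` is nonnegative.
      have hmax : ∀ x, ∃ a, ∀ b, t x b ≤ t x a := fun x => by
        simpa using Finset.exists_max_image Finset.univ (t x) Finset.univ_nonempty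
      choose f hf using hmax
      calc ∑ x, ∑ a, p x a * (τ * M x a).trace.re ≤ ∑ x, t x (f x) := by
            refine Finset.sum_le_sum fun x _ => ?_
            rw [← one_mul (t x (f x)), ← hp1 x, Finset.sum_mul]
            refine Finset.sum_le_sum fun a _ => mul_le_mul_of_nonneg_left ?_ (hp0 x a)
            induction a using Fin.lastCases with
            | last => simpa [hM] using ht0 x (f x)
            | cast a =>
              simp only [hM, Fin.snoc_castSucc]
              rw [trace_mul_vecMulVec_star]
              exact hf x a
        _ ≤ (1 + ((Fintype.card (Fin m) : ℝ) - 1) * μ) * τ.trace.re := by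
            refine sum_dotProduct_mulVec_le_of_overlap hτ.posSemidef
              (fun x => star (v x (f x))) hμ (fun x => ?_) (fun x y hxy => ?_)
            · rw [hstar, horth, if_pos rfl, star_one]
            · rw [hstar, norm_star]
              exact hoverlap x y hxy _ _
        _ = _ := by simp [hτ.trace_eq_one]
    · refine hval.trans_le (Finset.sum_le_sum fun x _ => ?_)
      rw [Fin.sum_univ_castSucc]
      simp only [hM, Fin.snoc_castSucc, Fin.snoc_last, mul_zero, Matrix.trace_zero,
        Complex.zero_re, add_zero]
      refine Finset.sum_le_sum fun a _ => ?_
      rw [trace_assemblage_mul]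
      simp [hP]

end QSteer

/-! ### Quadratic phase bases in prime dimension -/

section Chirp

variable {q : ℕ} [NeZero q]

lemma star_stdAddChar (x : ZMod q) :
    starRingEnd ℂ (ZMod.stdAddChar x) = ZMod.stdAddChar (-x) :=
  (AddChar.map_neg_eq_conj _ x).symm

lemma sum_stdAddChar_mul (b : ZMod q) :
    ∑ t : ZMod q, (ZMod.stdAddChar (b * t) : ℂ) = if b = 0 then (q : ℂ) else 0 := by
  have h := AddChar.sum_mulShift b (ZMod.isPrimitive_stdAddChar q)
  simp only [ZMod.card] at h
  simp only [mul_comm b]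
  rw [h]
  split_ifs <;> simp

/-- Expand `|G|²` and substitute `t = s + u`: the terms in `u²` cancel, leaving a character of
frequency `2 a s` in `u`. Its sum vanishes unless `s = 0`, because `2 a` is invertible; this is
where `q` must be odd. -/
lemma norm_sum_stdAddChar_quadratic [Fact q.Prime] (hq : q ≠ 2) {a : ZMod q} (ha : a ≠ 0)
    (b : ZMod q) : ‖∑ t : ZMod q, (ZMod.stdAddChar (a * t ^ 2 + b * t) : ℂ)‖ = Real.sqrt q := by
  have h2 : (2 : ZMod q) ≠ 0 := by
    intro h
    have : q ∣ 2 := (ZMod.natCast_eq_zero_iff 2 q).mp (by exact_mod_cast h)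
    exact hq ((Nat.prime_dvd_prime_iff_eq Fact.out Nat.prime_two).mp this)
  set G : ℂ := ∑ t : ZMod q, (ZMod.stdAddChar (a * t ^ 2 + b * t) : ℂ) with hG
  have h : starRingEnd ℂ G * G = q := by
    calc starRingEnd ℂ G * G
        = ∑ u : ZMod q, ∑ t : ZMod q, (ZMod.stdAddChar (-(a * u ^ 2 + b * u)) : ℂ) *
            ZMod.stdAddChar (a * t ^ 2 + b * t) := by
          rw [hG, map_sum, Finset.sum_mul_sum]
          simp only [star_stdAddChar]
      _ = ∑ u : ZMod q, ∑ s : ZMod q, (ZMod.stdAddChar (a * s ^ 2 + b * s) : ℂ) *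
            ZMod.stdAddChar (2 * a * s * u) := by
          refine Finset.sum_congr rfl fun u _ => ?_
          rw [← Equiv.sum_comp (Equiv.addRight u)]
          refine Finset.sum_congr rfl fun s _ => ?_
          rw [← AddChar.map_add_eq_mul, ← AddChar.map_add_eq_mul, Equiv.coe_addRight]
          congr 1
          ring
      _ = ∑ s : ZMod q, (ZMod.stdAddChar (a * s ^ 2 + b * s) : ℂ) *
            if s = 0 then (q : ℂ) else 0 := by
          rw [Finset.sum_comm]
          refine Finset.sum_congr rfl fun s _ => ?_
          rw [← Finset.mul_sum, sum_stdAddChar_mul]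
          simp [h2, ha]
      _ = q := by simp
  rw [Complex.conj_mul'] at h
  have h' : ‖G‖ ^ 2 = q := by exact_mod_cast h
  rw [← h', Real.sqrt_sq (norm_nonneg _)]

/-- The `a`-th vector of the `x`-th quadratic phase basis of `ℂ^q`. -/
noncomputable def chirp (q : ℕ) [NeZero q] (x a : ZMod q) : ZMod q → ℂ :=
  fun t => ((1 / Real.sqrt q : ℝ) : ℂ) * ZMod.stdAddChar (x * t ^ 2 + a * t)

lemma star_chirp_dotProduct_chirp (x a y b : ZMod q) :
    star (chirp q x a) ⬝ᵥ chirp q y b =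
      1 / q * ∑ t : ZMod q, (ZMod.stdAddChar ((y - x) * t ^ 2 + (b - a) * t) : ℂ) := by
  have hs : (((1 / Real.sqrt q : ℝ) : ℂ)) * ((1 / Real.sqrt q : ℝ) : ℂ) = 1 / q := by
    rw [← Complex.ofReal_mul, div_mul_div_comm, Real.mul_self_sqrt (Nat.cast_nonneg q)]
    simp
  rw [dotProduct, Finset.mul_sum]
  refine Finset.sum_congr rfl fun t _ => ?_
  simp only [chirp, Pi.star_apply, ← starRingEnd_apply, map_mul, Complex.conj_ofReal,
    star_stdAddChar]
  rw [mul_mul_mul_comm, hs, ← AddChar.map_add_eq_mul]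
  congr 2
  ring

lemma star_chirp_dotProduct_chirp_same (x a b : ZMod q) :
    star (chirp q x a) ⬝ᵥ chirp q x b = if a = b then 1 else 0 := by
  rw [star_chirp_dotProduct_chirp]
  simp only [sub_self, zero_mul, zero_add, sum_stdAddChar_mul, sub_eq_zero, eq_comm (a := b)]
  split_ifs <;> simp [NeZero.ne q]

lemma norm_star_chirp_dotProduct_chirp [Fact q.Prime] (hq : q ≠ 2) {x y : ZMod q} (hxy : x ≠ y)
    (a b : ZMod q) : ‖star (chirp q x a) ⬝ᵥ chirp q y b‖ = 1 / Real.sqrt q := by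
  rw [star_chirp_dotProduct_chirp, norm_mul,
    norm_sum_stdAddChar_quadratic hq (sub_ne_zero.mpr hxy.symm)]
  have hq0 : (0 : ℝ) < q := by exact_mod_cast Nat.pos_of_ne_zero (NeZero.ne q)
  have := Real.sqrt_pos.mpr hq0
  simp only [norm_div, norm_one, Complex.norm_natCast]
  rw [one_div_mul_eq_div, div_eq_div_iff hq0.ne' this.ne', Real.mul_self_sqrt hq0.le, one_mul]

end Chirp

lemma star_extend_dotProduct_extend {T A : Type} [Fintype T] [Fintype A] {e : T → A}
    (he : Function.Injective e) (f g : T → ℂ) :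
    star (Function.extend e f 0) ⬝ᵥ Function.extend e g 0 = star f ⬝ᵥ g := by
  refine (Fintype.sum_of_injective e he _ _ (fun i hi => ?_) (fun t => ?_)).symm
  · rw [Function.extend_apply' (f := e) (g := g) _ _ (by simpa using hi)]
    simp
  · simp [he.extend_apply]

/-! ### Two copies of the isotropic state, and the choice of the prime -/

namespace QSteer

lemma isotropicState_posSemidef {d : ℕ} (hd : 2 ≤ d) {F : ℝ} (hF0 : 0 ≤ F) (hF1 : F ≤ 1) :
    (isotropicState d F).PosSemidef ∧
      (isotropicState d F - (F : ℂ) • maxEntangledProj d).PosSemidef := by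
  have hps : ∀ Q : Matrix (Fin d × Fin d) (Fin d × Fin d) ℂ, IsStarProjection Q →
      Q.PosSemidef := by
    intro Q hQ
    have h : Q = Qᴴ * Q := by
      rw [← Matrix.star_eq_conjTranspose, hQ.isSelfAdjoint.star_eq, hQ.isIdempotentElem.eq]
    rw [h]
    exact Matrix.posSemidef_conjTranspose_mul_self Q
  have hQ := isStarProjection_maxEntangledProj (d := d) (by omega)
  have hd' : (2 : ℝ) ≤ d := by exact_mod_cast hd
  have hp : 0 ≤ (1 - F) / ((d : ℝ) ^ 2 - 1) :=
    div_nonneg (by linarith) (by nlinarith)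
  have h1 := (hps _ hQ).smul (Complex.zero_le_real.mpr hF0)
  have h2 := (hps _ hQ.one_sub).smul (Complex.zero_le_real.mpr hp)
  rw [isotropicState_eq, add_sub_cancel_left]
  exact ⟨h1.add h2, h2⟩

lemma le_dotProduct_copies_isotropicState {d : ℕ} (hd : 2 ≤ d) {F : ℝ} (hF0 : 0 ≤ F)
    (hF1 : F ≤ 1) {v : (Fin 2 → Fin d) → ℂ} (hv : star v ⬝ᵥ v = 1) :
    F ^ 2 / (d : ℝ) ^ 2 ≤
      (star (conjPair v) ⬝ᵥ copies 2 (isotropicState d F) *ᵥ conjPair v).re := by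
  obtain ⟨hρ, hrest⟩ := isotropicState_posSemidef hd hF0 hF1
  set ρ := isotropicState d F with hρdef
  set ψ : Matrix (Fin d × Fin d) (Fin d × Fin d) ℂ := maxEntangledProj d with hψ
  have hψps : ψ.PosSemidef := Matrix.posSemidef_vecMulVec_self_star _
  have hFψ : ((F : ℂ) • ψ).PosSemidef := hψps.smul (Complex.zero_le_real.mpr hF0)
  set Ψ : (Fin 2 → Fin d) × (Fin 2 → Fin d) → ℂ :=
    fun s => if s.1 = s.2 then ((1 / d : ℝ) : ℂ) else 0 with hΨ
  have hsq : (((1 / Real.sqrt d : ℝ) : ℂ)) * ((1 / Real.sqrt d : ℝ) : ℂ) = ((1 / d : ℝ) : ℂ) := by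
    rw [← Complex.ofReal_mul, div_mul_div_comm, Real.mul_self_sqrt (Nat.cast_nonneg d), one_mul]
  have hsq' : ((Real.sqrt d : ℝ) : ℂ)⁻¹ * ((Real.sqrt d : ℝ) : ℂ)⁻¹ = (d : ℂ)⁻¹ := by
    simpa using hsq
  have hvec : ∀ s : (Fin 2 → Fin d) × (Fin 2 → Fin d),
      Ψ s = maxEntangledVec d (s.1 0, s.2 0) * maxEntangledVec d (s.1 1, s.2 1) := by
    intro s
    simp only [hΨ, maxEntangledVec, funext_iff, Fin.forall_fin_two]
    by_cases h0 : s.1 0 = s.2 0 <;> by_cases h1 : s.1 1 = s.2 1 <;> simp [h0, h1, hsq']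
  have hdecomp : (copies 2 ρ - ((F ^ 2 : ℝ) : ℂ) • Matrix.vecMulVec Ψ (star Ψ)).PosSemidef := by
    -- With `R = ρ - F ψ ≥ 0`, the identity `ρ ⊗ ρ - F² ψ ⊗ ψ = F ψ ⊗ R + R ⊗ ρ` exhibits the
    -- difference as a sum of positive terms. The submatrix only regroups the tensor factors.
    have heq : copies 2 ρ - ((F ^ 2 : ℝ) : ℂ) • Matrix.vecMulVec Ψ (star Ψ) =
        (((F : ℂ) • ψ) ⊗ₖ (ρ - (F : ℂ) • ψ) + (ρ - (F : ℂ) • ψ) ⊗ₖ ρ).submatrix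
          (fun s => ((s.1 0, s.2 0), (s.1 1, s.2 1)))
          (fun s => ((s.1 0, s.2 0), (s.1 1, s.2 1))) := by
      ext s t
      simp only [copies, Fin.prod_univ_two, Matrix.sub_apply, Matrix.smul_apply, Matrix.add_apply,
        Matrix.submatrix_apply, Matrix.kroneckerMap_apply, Matrix.of_apply, hψ, maxEntangledProj,
        Matrix.vecMulVec_apply, Pi.star_apply, hvec, star_mul', smul_eq_mul]
      push_cast
      ring
    rw [heq]
    exact ((hFψ.kronecker hrest).add (hrest.kronecker hρ)).submatrix _
  have hq := hdecomp.re_dotProduct_nonneg (conjPair v)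
  have hdot : star Ψ ⬝ᵥ conjPair v = ((1 / d : ℝ) : ℂ) := by
    have hterm : ∀ i j, star Ψ (i, j) * conjPair v (i, j) =
        if i = j then ((1 / d : ℝ) : ℂ) * (star (v i) * v i) else 0 := by
      intro i j
      simp only [hΨ, Pi.star_apply, conjPair]
      split_ifs with hij
      · rw [← hij, ← starRingEnd_apply, Complex.conj_ofReal]
        ring
      · simp
    rw [dotProduct, Fintype.sum_prod_type]
    simp only [hterm, Finset.sum_ite_eq, Finset.mem_univ, if_true]
    rw [← Finset.mul_sum]
    change _ * (star v ⬝ᵥ v) = _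
    rw [hv, mul_one]
  have hval : star (conjPair v) ⬝ᵥ Matrix.vecMulVec Ψ (star Ψ) *ᵥ conjPair v =
      (((1 / d : ℝ) ^ 2 : ℝ) : ℂ) := by
    rw [Matrix.vecMulVec_mulVec, hdot, dotProduct_smul, op_smul_eq_smul, smul_eq_mul]
    have : star (conjPair v) ⬝ᵥ Ψ = star (star Ψ ⬝ᵥ conjPair v) := by
      rw [Matrix.star_dotProduct]
    rw [this, hdot, ← starRingEnd_apply, Complex.conj_ofReal]
    push_cast
    ring
  rw [Matrix.sub_mulVec, dotProduct_sub, Matrix.smul_mulVec, dotProduct_smul, hval, smul_eq_mul,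
    ← Complex.ofReal_mul] at hq
  simp only [map_sub, RCLike.re_to_complex, Complex.ofReal_re] at hq
  have e : F ^ 2 / (d : ℝ) ^ 2 = F ^ 2 * (1 / d) ^ 2 := by ring
  rw [e]
  linarith

/-- Two copies of an isotropic state are steerable if the quadratic phase bases of some prime
dimension `q ≤ d²` detect it. -/
theorem isKCopySteerableProjective_two_of_prime {d q : ℕ} (hd : 2 ≤ d) (hq : q.Prime)
    (hq2 : q ≠ 2) (hqd : q ≤ d ^ 2) {F : ℝ} (hF0 : 0 ≤ F) (hF1 : F ≤ 1)
    (h : 1 + ((q : ℝ) - 1) * (1 / Real.sqrt q) < q ^ 2 * (F ^ 2 / (d : ℝ) ^ 2)) :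
    IsKCopySteerableProjective 2 (isotropicState d F) := by
  have : Fact q.Prime := ⟨hq⟩
  have : NeZero q := ⟨hq.ne_zero⟩
  obtain ⟨e⟩ : Nonempty (ZMod q ↪ (Fin 2 → Fin d)) := by
    rw [Function.Embedding.nonempty_iff_card_le]
    simpa [ZMod.card] using hqd
  set c : Fin q → ZMod q := fun x => ((x : ℕ) : ZMod q) with hc
  have hcinj : Function.Injective c := by
    intro x y hxy
    rw [hc] at hxy
    have := (ZMod.natCast_eq_natCast_iff' _ _ _).mp hxy
    rw [Nat.mod_eq_of_lt x.2, Nat.mod_eq_of_lt y.2] at this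
    exact Fin.ext this
  have horth : ∀ (x a b : Fin q), star (Function.extend e (chirp q (c x) (c a)) 0) ⬝ᵥ
      Function.extend e (chirp q (c x) (c b)) 0 = if a = b then 1 else 0 := by
    intro x a b
    rw [star_extend_dotProduct_extend e.injective, star_chirp_dotProduct_chirp_same]
    simp [hcinj.eq_iff]
  refine isSteerableProjective_of_overlap (m := q) (n := q) (μ := 1 / Real.sqrt q) _
    (fun x a => Function.extend e (chirp q (c x) (c a)) 0) (by positivity) horth
    (fun x y hxy a b => ?_) ?_
  · rw [star_extend_dotProduct_extend e.injective,
      norm_star_chirp_dotProduct_chirp hq2 (hcinj.ne hxy)]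
  · refine h.trans_le ?_
    calc (q : ℝ) ^ 2 * (F ^ 2 / (d : ℝ) ^ 2)
        = ∑ _x : Fin q, ∑ _a : Fin q, F ^ 2 / (d : ℝ) ^ 2 := by
          simp
          ring
      _ ≤ _ := Finset.sum_le_sum fun x _ => Finset.sum_le_sum fun a _ =>
          le_dotProduct_copies_isotropicState hd hF0 hF1 (by rw [horth, if_pos rfl])

/-- Replaces `√q` by a rational lower bound `s`, leaving rational arithmetic. -/
lemma chirp_bound_le {q : ℕ} {s B : ℝ} (hq : 1 ≤ q) (hs : 0 < s) (hsq : s ^ 2 ≤ q)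
    (hB : 1 + ((q : ℝ) - 1) * (1 / s) ≤ B) : 1 + ((q : ℝ) - 1) * (1 / Real.sqrt q) ≤ B := by
  have h1 : s ≤ Real.sqrt q := Real.le_sqrt_of_sq_le hsq
  have h2 : (0 : ℝ) ≤ (q : ℝ) - 1 := sub_nonneg.mpr (by exact_mod_cast hq)
  refine le_trans ?_ hB
  gcongr

lemma exists_prime_chirp_bound {d : ℕ} (hd : 6 ≤ d) :
    ∃ q : ℕ, q.Prime ∧ q ≠ 2 ∧ q ≤ d ^ 2 ∧
      1 + ((q : ℝ) - 1) * (1 / Real.sqrt q) ≤ q ^ 2 * (1 / 4) / (d : ℝ) ^ 2 := by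
  rcases lt_or_ge d 13 with h | h
  · interval_cases d
    -- In each case `q` is the largest prime below `d²`. The margin is thinnest here: `s = 5` would
    -- give `7`, above the target `961/144`, hence the finer `5.56`. The later cases take `s =
    -- ⌊√q⌋`.
    · exact ⟨31, by norm_num, by norm_num, by norm_num,
        chirp_bound_le (s := 5.56) (by norm_num) (by norm_num) (by norm_num) (by norm_num)⟩
    · exact ⟨47, by norm_num, by norm_num, by norm_num,
        chirp_bound_le (s := 6) (by norm_num) (by norm_num) (by norm_num) (by norm_num)⟩
    · exact ⟨61, by norm_num, by norm_num, by norm_num,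
        chirp_bound_le (s := 7) (by norm_num) (by norm_num) (by norm_num) (by norm_num)⟩
    · exact ⟨79, by norm_num, by norm_num, by norm_num,
        chirp_bound_le (s := 8) (by norm_num) (by norm_num) (by norm_num) (by norm_num)⟩
    · exact ⟨97, by norm_num, by norm_num, by norm_num,
        chirp_bound_le (s := 9) (by norm_num) (by norm_num) (by norm_num) (by norm_num)⟩
    · exact ⟨113, by norm_num, by norm_num, by norm_num,
        chirp_bound_le (s := 10) (by norm_num) (by norm_num) (by norm_num) (by norm_num)⟩
    · exact ⟨139, by norm_num, by norm_num, by norm_num,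
        chirp_bound_le (s := 11) (by norm_num) (by norm_num) (by norm_num) (by norm_num)⟩
  · have hd2 : 169 ≤ d ^ 2 := by nlinarith
    -- Bertrand's postulate gives `d² ≤ 2q`, so the target is at least `q/8`, which outgrows `√q`.
    -- From `d = 13` on, `q ≥ 85`, and `9.2² ≤ 85`.
    obtain ⟨q, hq, hlt, hle⟩ := Nat.exists_prime_lt_and_le_two_mul (d ^ 2 / 2) (by omega)
    have hq85 : 85 ≤ q := by omega
    have hqd : d ^ 2 ≤ 2 * q := by omega
    refine ⟨q, hq, by omega, by omega, chirp_bound_le (s := 9.2) hq.one_le (by norm_num) ?_ ?_⟩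
    · have : (85 : ℝ) ≤ q := by exact_mod_cast hq85
      norm_num
      linarith
    · have h1 : (85 : ℝ) ≤ q := by exact_mod_cast hq85
      have h2 : (d : ℝ) ^ 2 ≤ 2 * q := by exact_mod_cast hqd
      have h3 : (0 : ℝ) < (d : ℝ) ^ 2 := by
        have : (169 : ℝ) ≤ (d : ℝ) ^ 2 := by exact_mod_cast hd2
        linarith
      have h4 : (q : ℝ) / 8 ≤ q ^ 2 * (1 / 4) / (d : ℝ) ^ 2 := by
        rw [div_le_div_iff₀ (by norm_num) h3]
        nlinarith
      refine le_trans ?_ h4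
      norm_num
      linarith

end QSteer

theorem proposition8 (d : ℕ) (hd : 6 ≤ d) (F : ℝ) (hF0 : 0 ≤ F) (hF1 : F ≤ 1)
    (α : ℝ) (hα0 : 0 < α) (hα1 : α < 1)
    (hneg : QSteer.condKaniadakisEntropy α (QSteer.isotropicState d F) < 0) :
    QSteer.IsKCopySteerableProjective 2 (QSteer.isotropicState d F) := by
  have hF := QSteer.half_lt_of_condKaniadakisEntropy_neg (by omega) hF0 hF1 hα0 hα1 hneg
  obtain ⟨q, hq, hq2, hqd, hbound⟩ := QSteer.exists_prime_chirp_bound hd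
  refine QSteer.isKCopySteerableProjective_two_of_prime (by omega) hq hq2 hqd hF0 hF1
    (hbound.trans_lt ?_)
  have hq0 : (0 : ℝ) < q := by exact_mod_cast hq.pos
  have hd0 : (0 : ℝ) < d := by exact_mod_cast (by omega : 0 < d)
  rw [mul_div_assoc]
  gcongr
  nlinarith
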